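/- Let $\mathcal X=\{x\in\mathbb R^D: Gx\le h\}$ be a polyhedron (e.g. a polytope), let $A(x)\in\mathbb R^{M\times K}$ and $b(x)\in\mathbb R^K$ be affine in $x$, let $c$ be a quadratic function that is convex on $\mathcal X$, and let $$\Xi=\{\xi\in\mathbb R_+^K:\ S\xi=t,\ \xi_\ell\in\mathbb Z\ (\ell=1,\dots,L)\},\qquad S\in\mathbb R^{J\times K},\ t\in\mathbb R^J,\ L\le K,$$ be nonempty and bounded. Put $Z(x)=\sup_{\xi\in\Xi}\|A(x)\xi\|_2^2+b(x)^\top\xi+c(x)$ and consider the robust convex quadratic program $$\text{(RO)}\qquad \min_{x\in\mathcal X} Z(x).$$ There is $Q\in\mathbb Z_+$ with $\xi_\ell\in\{0,\dots,2^Q-1\}$ for all $\xi\in\Xi$, $\ell\le L$. For any such $Q$ put $\mathbf v_Q=(2^0,\dots,2^{Q-1})^\top$, $K'=2LQ+K$, $J'=J+L+LQ$. Writing vectors of $\mathbb R^{K'}$ as $(\chi_1,\dots,\chi_L,\eta_1,\dots,\eta_L,\xi)$ with $\chi_\ell,\eta_\ell\in\mathbb R^Q$, $\xi\in\mathbb R^K$,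 let $\mathcal S\in\mathbb R^{J'\times K'}$ and $\mathscr t=(t,\mathbf 0,\mathbf 1)\in\mathbb R^{J'}$ be the matrix and right-hand side of the linear system $$S\xi=t,\qquad -\mathbf v_Q^\top\chi_\ell+\xi_\ell=0\ (\ell\le L),\qquad \chi_\ell+\eta_\ell=\mathbf 1\ (\ell\le L),$$ and let $\mathcal A(x)=[0\ \ 0\ \ A(x)]\in\mathbb R^{M\times K'}$, $\mathscr b(x)=(0,0,b(x))\in\mathbb R^{K'}$. Consider the copositive program $$\text{(COP)}\qquad\begin{array}{ll}\min & c(x)+\mathscr t^\top\psi+(\mathscr t\circ\mathscr t)^\top\phi+\tau\\ \text{s.t.}& x\in\mathcal X,\ \tau\in\mathbb R,\ \psi,\phi\in\mathbb R^{J'},\ \gamma\in\mathbb R^{LQ},\ H\in\mathbb S_+^{K'},\\[2pt] &\begin{bmatrix}\mathbb I&\mathcal A(x)\\ \mathcal A(x)^\top&H\end{bmatrix}\succeq0,\\[6pt] &\begin{bmatrix}\mathcal S^\top\mathrm{diag}(\phi)\mathcal S-H-\mathrm{diag}(\gamma,0)&\tfrac12(\mathcal S^\top\psi-\mathscr b(x)+(\gamma,0))\\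 \tfrac12(\mathcal S^\top\psi-\mathscr b(x)+(\gamma,0))^\top&\tau\end{bmatrix}\ \text{is copositive},\end{array}$$ where a symmetric matrix $B$ is copositive if $v^\top Bv\ge0$ for all $v\ge0$, and $(\gamma,0)\in\mathbb R^{K'}$ is $\gamma$ followed by zeros. Then (RO) and (COP) are equivalent in the following sense (all optimal values in $[-\infty,\infty]$): for every $x\in\mathcal X$, $Z(x)$ is the infimum of the objective of (COP) over all its feasible points with that $x$; the two programs have the same optimal value; a point $x\in\mathcal X$ is optimal for (RO) if and only if the infimum of (COP) with $x$ fixed equals the optimal value of (COP); and if $(x,\tau,\psi,\phi,\gamma,H)$ is optimal for (COP), then $x$ is optimal for (RO) and $Z(x)$ is the optimal value of (COP). Moreover, (COP) has polynomial size: there are universal polynomials $p,q$ such that whenever all data are rational (and $\Xi$ is nonempty and bounded), there is a $Q$ as above with $Q\le p(\text{bit length of }(S,t))$ for which the size of (COP) is at most $q(\text{size of (RO)})$. Here the size of (RO) is the sum of its dimensions $D,M,K,J,L,N$ ($N$ the number of rows of $G$) and the bit length of all its data, and the size of (COP) is the number of its scalar variables, plus the number of linear inequalities and the orders of its two semidefinite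 constraints and its copositive constraint, plus the bit length of its data ($G$, $h$, the coefficients of $c$, $\mathcal A$, $\mathscr b$, and $\mathcal S$, $\mathscr t$). -/

import Mathlib

open scoped Matrix

/-- A matrix is copositive if it is symmetric and its quadratic form is nonnegative on the
nonnegative orthant. -/
def IsCopositive {n : Type} [Fintype n] (B : Matrix n n ℝ) : Prop :=
  B.IsSymm ∧ ∀ v : n → ℝ, 0 ≤ v → 0 ≤ v ⬝ᵥ (B *ᵥ v)

/-- The data, over a ring `R`, of the robust quadratic program
`minimize sup_{ξ ∈ Ξ} ‖A(x) ξ‖² + b(x)ᵀ ξ + c(x)` over `x ∈ X`, with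
`X = {x ∈ ℝ^D | G x ≤ h}`, `A(x) = A₀ + ∑ i, x_i A₁ i`, `b(x) = b₀ + ∑ i, x_i b₁ i`,
`c(x) = xᵀ C x + dᵀ x + e`, and
`Ξ = {ξ ∈ ℝ^K | ξ ≥ 0, S ξ = t, the first L coordinates of ξ are integers}`. -/
structure RobustQP (R : Type) (D M K J L N : ℕ) where
  hL : L ≤ K
  G : Matrix (Fin N) (Fin D) R
  h : Fin N → R
  A₀ : Matrix (Fin M) (Fin K) R
  A₁ : Fin D → Matrix (Fin M) (Fin K) R
  b₀ : Fin K → R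
  b₁ : Fin D → Fin K → R
  C : Matrix (Fin D) (Fin D) R
  d : Fin D → R
  e : R
  S : Matrix (Fin J) (Fin K) R
  t : Fin J → R

/-- Index set of the expanded uncertain vector `(χ_1, …, χ_L, η_1, …, η_L, ξ)`;
it has `K' = 2 L Q + K` elements. -/
abbrev VarIdx (L Q K : ℕ) : Type := (Fin L × Fin Q) ⊕ ((Fin L × Fin Q) ⊕ Fin K)

/-- Index set of the rows of the expanded equality system;
it has `J' = J + L + L Q` elements. -/
abbrev RowIdx (L Q J : ℕ) : Type := Fin J ⊕ (Fin L ⊕ (Fin L × Fin Q))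

/-- The matrix `[0 ⋯ 0 | 0 ⋯ 0 | B]` with `K'` columns. -/
def padMatrix {R : Type} [Zero R] {M K : ℕ} (L Q : ℕ) (B : Matrix (Fin M) (Fin K) R) :
    Matrix (Fin M) (VarIdx L Q K) R :=
  Matrix.fromCols 0 (Matrix.fromCols 0 B)

/-- The vector `(0, …, 0, 0, …, 0, v)` of length `K'`. -/
def padVector {R : Type} [Zero R] {K : ℕ} (L Q : ℕ) (v : Fin K → R) : VarIdx L Q K → R :=
  Sum.elim 0 (Sum.elim 0 v)

/-- The block-diagonal `L × L Q` matrix whose diagonal blocks are the rows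
`(2^0, 2^1, …, 2^(Q-1))`. -/
def binaryWeights (R : Type) [Ring R] (L Q : ℕ) : Matrix (Fin L) (Fin L × Fin Q) R :=
  Matrix.of fun l p => if l = p.1 then 2 ^ (p.2 : ℕ) else 0

/-- The `L × K` matrix whose rows are the first `L` standard basis vectors. -/
def firstCoords (R : Type) [Ring R] {L K : ℕ} (hL : L ≤ K) : Matrix (Fin L) (Fin K) R :=
  Matrix.of fun l k => if Fin.castLE hL l = k then 1 else 0

namespace RobustQP

variable {R : Type} {D M K J L N : ℕ}

/-- The expanded constraint matrix: its row blocks encode `S ξ = t`,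
`ξ_l - ∑ q, 2^q χ_{l,q} = 0` and `χ_l + η_l = 1`. -/
def expS [Ring R] (P : RobustQP R D M K J L N) (Q : ℕ) :
    Matrix (RowIdx L Q J) (VarIdx L Q K) R :=
  Matrix.fromRows (Matrix.fromCols 0 (Matrix.fromCols 0 P.S))
    (Matrix.fromRows
      (Matrix.fromCols (-binaryWeights R L Q) (Matrix.fromCols 0 (firstCoords R P.hL)))
      (Matrix.fromCols 1 (Matrix.fromCols 1 0)))

/-- The expanded right-hand side `(t, 0, 1)`. -/
def expT [Ring R] (P : RobustQP R D M K J L N) (Q : ℕ) : RowIdx L Q J → R :=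
  Sum.elim P.t (Sum.elim 0 1)

/-- The feasible set `X` of the decisions. -/
def X (P : RobustQP ℝ D M K J L N) : Set (Fin D → ℝ) := {x | P.G *ᵥ x ≤ P.h}

/-- The affine matrix function `A(x)`. -/
def A (P : RobustQP ℝ D M K J L N) (x : Fin D → ℝ) : Matrix (Fin M) (Fin K) ℝ :=
  P.A₀ + ∑ i, x i • P.A₁ i

/-- The affine vector function `b(x)`. -/
def b (P : RobustQP ℝ D M K J L N) (x : Fin D → ℝ) : Fin K → ℝ :=
  P.b₀ + ∑ i, x i • P.b₁ i

/-- The quadratic function `c(x)`. -/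
def c (P : RobustQP ℝ D M K J L N) (x : Fin D → ℝ) : ℝ :=
  x ⬝ᵥ (P.C *ᵥ x) + P.d ⬝ᵥ x + P.e

/-- The mixed-integer polyhedral uncertainty set `Ξ`. -/
def uncertaintySet (P : RobustQP ℝ D M K J L N) : Set (Fin K → ℝ) :=
  {ξ | 0 ≤ ξ ∧ P.S *ᵥ ξ = P.t ∧ ∀ l : Fin L, ∃ z : ℤ, ξ (Fin.castLE P.hL l) = z}

/-- `Q` bits suffice for the integer coordinates: `ξ_l ∈ {0, …, 2^Q - 1}` on `Ξ`. -/
def IsBitBound (P : RobustQP ℝ D M K J L N) (Q : ℕ) : Prop :=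
  ∀ ξ ∈ P.uncertaintySet, ∀ l : Fin L, ξ (Fin.castLE P.hL l) ≤ 2 ^ Q - 1

/-- The worst-case cost `Z(x)`; the norm is the Euclidean one. -/
noncomputable def worstCase (P : RobustQP ℝ D M K J L N) (x : Fin D → ℝ) : EReal :=
  ⨆ ξ ∈ P.uncertaintySet,
    ((‖WithLp.toLp 2 (P.A x *ᵥ ξ)‖ ^ 2 + P.b x ⬝ᵥ ξ + P.c x : ℝ) : EReal)

/-- The optimal value of the robust quadratic program. -/
noncomputable def robustValue (P : RobustQP ℝ D M K J L N) : EReal :=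
  ⨅ x ∈ P.X, P.worstCase x

/-- `x` is an optimal solution of the robust quadratic program. -/
def IsRobustOptimal (P : RobustQP ℝ D M K J L N) (x : Fin D → ℝ) : Prop :=
  x ∈ P.X ∧ ∀ x' ∈ P.X, P.worstCase x ≤ P.worstCase x'

end RobustQP

/-- The decision variables of the copositive program other than `x`. -/
structure CopVars (K J L Q : ℕ) where
  τ : ℝ
  ψ : RowIdx L Q J → ℝ
  φ : RowIdx L Q J → ℝ
  γ : Fin L × Fin Q → ℝ
  H : Matrix (VarIdx L Q K) (VarIdx L Q K) ℝ

/-- The vector `(γ, 0)` of length `K'`. -/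
def CopVars.γ₀ {K J L Q : ℕ} (y : CopVars K J L Q) : VarIdx L Q K → ℝ :=
  Sum.elim y.γ 0

namespace RobustQP

variable {D M K J L N : ℕ}

/-- The column `½ (𝒮ᵀ ψ - 𝒷(x) + (γ, 0))`. -/
noncomputable def copColumn (P : RobustQP ℝ D M K J L N) (Q : ℕ) (x : Fin D → ℝ)
    (y : CopVars K J L Q) : VarIdx L Q K → ℝ :=
  (1 / 2 : ℝ) • ((P.expS Q)ᵀ *ᵥ y.ψ - padVector L Q (P.b x) + y.γ₀)

/-- The matrix of the copositive constraint, of order `K' + 1`. -/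
noncomputable def copMatrix (P : RobustQP ℝ D M K J L N) (Q : ℕ) (x : Fin D → ℝ)
    (y : CopVars K J L Q) : Matrix (VarIdx L Q K ⊕ Unit) (VarIdx L Q K ⊕ Unit) ℝ :=
  Matrix.fromBlocks
    ((P.expS Q)ᵀ * Matrix.diagonal y.φ * P.expS Q - y.H - Matrix.diagonal y.γ₀)
    (Matrix.replicateCol Unit (P.copColumn Q x y))
    (Matrix.replicateRow Unit (P.copColumn Q x y))
    (Matrix.of fun _ _ => y.τ)

/-- Feasibility of `(x, τ, ψ, φ, γ, H)` in the copositive program. -/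
def IsCopFeasible (P : RobustQP ℝ D M K J L N) (Q : ℕ) (x : Fin D → ℝ)
    (y : CopVars K J L Q) : Prop :=
  x ∈ P.X ∧ y.H.PosSemidef ∧
    (Matrix.fromBlocks (1 : Matrix (Fin M) (Fin M) ℝ) (padMatrix L Q (P.A x))
      (padMatrix L Q (P.A x))ᵀ y.H).PosSemidef ∧
    IsCopositive (P.copMatrix Q x y)

/-- The objective `c(x) + 𝓉ᵀ ψ + (𝓉 ∘ 𝓉)ᵀ φ + τ` of the copositive program. -/
def copObjective (P : RobustQP ℝ D M K J L N) (Q : ℕ) (x : Fin D → ℝ)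
    (y : CopVars K J L Q) : ℝ :=
  P.c x + P.expT Q ⬝ᵥ y.ψ + (P.expT Q * P.expT Q) ⬝ᵥ y.φ + y.τ

/-- The optimal value of the copositive program when the component `x` is kept fixed. -/
noncomputable def copSectionValue (P : RobustQP ℝ D M K J L N) (Q : ℕ)
    (x : Fin D → ℝ) : EReal :=
  ⨅ (y : CopVars K J L Q) (_ : P.IsCopFeasible Q x y), (P.copObjective Q x y : EReal)

/-- The optimal value of the copositive program. -/
noncomputable def copValue (P : RobustQP ℝ D M K J L N) (Q : ℕ) : EReal :=
  ⨅ (x : Fin D → ℝ) (y : CopVars K J L Q) (_ : P.IsCopFeasible Q x y),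
    (P.copObjective Q x y : EReal)

/-- `(x, y)` is an optimal solution of the copositive program. -/
def IsCopOptimal (P : RobustQP ℝ D M K J L N) (Q : ℕ) (x : Fin D → ℝ)
    (y : CopVars K J L Q) : Prop :=
  P.IsCopFeasible Q x y ∧ ∀ (x' : Fin D → ℝ) (y' : CopVars K J L Q),
    P.IsCopFeasible Q x' y' → P.copObjective Q x y ≤ P.copObjective Q x' y'

/-- An instance with rational data, read over the reals. -/
def toReal (P : RobustQP ℚ D M K J L N) : RobustQP ℝ D M K J L N where
  hL := P.hL
  G := P.G.map (fun r => (r : ℝ))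
  h := fun i => (P.h i : ℝ)
  A₀ := P.A₀.map (fun r => (r : ℝ))
  A₁ := fun i => (P.A₁ i).map (fun r => (r : ℝ))
  b₀ := fun i => (P.b₀ i : ℝ)
  b₁ := fun i k => (P.b₁ i k : ℝ)
  C := P.C.map (fun r => (r : ℝ))
  d := fun i => (P.d i : ℝ)
  e := (P.e : ℝ)
  S := P.S.map (fun r => (r : ℝ))
  t := fun i => (P.t i : ℝ)

end RobustQP

/-- The number of bits used to write a rational number: a sign bit, the binary digits of the
numerator and those of the denominator. -/
def ratBits (r : ℚ) : ℕ := 1 + Nat.size r.num.natAbs + Nat.size r.den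

/-- The number of bits used to write the entries of a rational vector. -/
def vecBits {n : Type} [Fintype n] (v : n → ℚ) : ℕ := ∑ i, ratBits (v i)

/-- The number of bits used to write the entries of a rational matrix. -/
def matBits {m n : Type} [Fintype m] [Fintype n] (B : Matrix m n ℚ) : ℕ :=
  ∑ i, ∑ j, ratBits (B i j)

namespace RobustQP

variable {D M K J L N : ℕ}

/-- The bit length of the description of `S` and `t`. -/
def setBits (P : RobustQP ℚ D M K J L N) : ℕ := matBits P.S + vecBits P.t

/-- The size of a rational instance of the robust quadratic program: its dimensions plus the
bit length of all its data. -/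
def inputSize (P : RobustQP ℚ D M K J L N) : ℕ :=
  D + M + K + J + L + N
    + (matBits P.G + vecBits P.h)
    + (matBits P.A₀ + ∑ i, matBits (P.A₁ i))
    + (vecBits P.b₀ + ∑ i, vecBits (P.b₁ i))
    + (matBits P.C + vecBits P.d + ratBits P.e)
    + P.setBits

/-- The number of scalar variables of the copositive program (`x`, `τ`, `ψ`, `φ`, `γ` and all
entries of `H`). -/
def copNumVars (_P : RobustQP ℚ D M K J L N) (Q : ℕ) : ℕ :=
  D + 1 + 2 * Fintype.card (RowIdx L Q J) + Fintype.card (Fin L × Fin Q)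
    + Fintype.card (VarIdx L Q K) ^ 2

/-- The number of linear inequalities plus the orders of the two semidefinite constraints and
of the copositive constraint. -/
def copConstraintSize (_P : RobustQP ℚ D M K J L N) (Q : ℕ) : ℕ :=
  N + Fintype.card (VarIdx L Q K) + Fintype.card (Fin M ⊕ VarIdx L Q K)
    + Fintype.card (VarIdx L Q K ⊕ Unit)

/-- The bit length of all data of the copositive program. -/
def copDataBits (P : RobustQP ℚ D M K J L N) (Q : ℕ) : ℕ :=
  (matBits P.G + vecBits P.h)
    + (matBits (padMatrix L Q P.A₀) + ∑ i, matBits (padMatrix L Q (P.A₁ i)))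
    + (vecBits (padVector L Q P.b₀) + ∑ i, vecBits (padVector L Q (P.b₁ i)))
    + (matBits P.C + vecBits P.d + ratBits P.e)
    + (matBits (P.expS Q) + vecBits (P.expT Q))

/-- The size of the copositive program. -/
def copSize (P : RobustQP ℚ D M K J L N) (Q : ℕ) : ℕ :=
  P.copNumVars Q + P.copConstraintSize Q + P.copDataBits Q

end RobustQP

/-! For fixed `x`, the copositive program is a dual of maximizing the scenario cost over `Ξ`, and
both duality inequalities are proved by hand. Weak duality (`le_copObjective`): write the integer
coordinates of a scenario in binary, with digits `χ` and complements `η = 1 - χ`. At this lifted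
point the linear system holds and `χ ∘ χ = χ`, so the copositive form evaluated there with last
coordinate `1` bounds the cost by the objective. Strong duality (`exists_isCopFeasible`): let `r`
strictly exceed every scenario cost. Homogenize with an extra coordinate `s` and work on the
standard simplex. The homogenized gap `f` is positive wherever the residual `e = 𝒮 z - s 𝓉` and the
complementarity term `g = ∑ χ (s - χ)` both vanish, because such points are multiples of lifted
scenarios. Two exact penalizations (`IsCompact.exists_pos_add_mul`) make `f + σ g + ρ ‖e‖²` positive
on the whole simplex, and this is the form of a feasible point with objective `r`. The
homogenization has no nonzero point at `s = 0`, by boundedness of `Ξ`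
(`eq_zero_of_expS_mulVec_eq_zero`). Polynomial size: for rational data, boundedness of `Ξ` passes to
its continuous relaxation, since a real recession direction would yield an integral one. Each
coordinate of a scenario is then dominated by that of a basic solution, which Cramer's rule bounds
by `2` to a polynomial in the bit length of `(S, t)`. With that many bits, the expanded data are
counted entry by entry. -/

open scoped Matrix

/-! ### Binary digits, exact penalization, quadratic forms on the simplex. -/

/-- A natural number below `2 ^ Q` is the sum of its first `Q` binary digits. -/
theorem sum_two_pow_mul_testBit (Q n : ℕ) (hn : n < 2 ^ Q) :
    ∑ q : Fin Q, 2 ^ (q : ℕ) * (if n.testBit q then 1 else 0) = n := by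
  induction Q generalizing n with
  | zero => simp at hn; simp [hn]
  | succ Q ih =>
    have h2 : n / 2 < 2 ^ Q := by rw [pow_succ] at hn; omega
    have := ih (n / 2) h2
    rw [Fin.sum_univ_succ]
    simp only [Fin.val_zero, Fin.val_succ, pow_zero, one_mul, pow_succ, Nat.testBit_succ,
      Nat.testBit_zero, decide_eq_true_eq]
    have h3 : ∑ x : Fin Q, 2 ^ (x : ℕ) * 2 * (if (n / 2).testBit x then 1 else 0) = 2 * (n / 2) := by
      rw [← this, Finset.mul_sum, this]
      exact Finset.sum_congr rfl fun _ _ => by ring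
    rw [h3]
    split_ifs <;> omega

/-- Exact penalization: on a compact set, a function that is positive on the zero set of a
nonnegative penalty becomes positive once a large multiple of the penalty is added. -/
theorem IsCompact.exists_pos_add_mul {X : Type*} [TopologicalSpace X] {s : Set X}
    (hs : IsCompact s) {f g : X → ℝ} (hf : Continuous f) (hg : Continuous g)
    (hg0 : ∀ x ∈ s, 0 ≤ g x) (hfg : ∀ x ∈ s, g x = 0 → 0 < f x) :
    ∃ r : ℝ, 0 ≤ r ∧ ∀ x ∈ s, 0 < f x + r * g x := by
  -- On `s` these open sets increase with `n`, as `g ≥ 0` there, so the largest index of a finite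
  -- subcover works for all of `s`.
  obtain ⟨u, hu⟩ := hs.elim_finite_subcover (fun n : ℕ => {x | 0 < f x + n * g x})
    (fun n => isOpen_lt continuous_const (hf.add (continuous_const.mul hg))) (by
      intro x hx
      rw [Set.mem_iUnion]
      rcases (hg0 x hx).eq_or_lt with h | h
      · exact ⟨0, by simpa using hfg x hx h.symm⟩
      · obtain ⟨n, hn⟩ := exists_nat_gt (-f x / g x)
        rw [div_lt_iff₀ h] at hn
        exact ⟨n, by simp only [Set.mem_ofPred_eq]; linarith⟩)
  refine ⟨(u.sup id : ℕ), Nat.cast_nonneg _, fun x hx => ?_⟩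
  obtain ⟨n, hn, hxn⟩ := Set.mem_iUnion₂.1 (hu hx)
  have h1 : (n : ℝ) ≤ (u.sup id : ℕ) := by exact_mod_cast Finset.le_sup (f := id) hn
  have h2 := mul_le_mul_of_nonneg_right h1 (hg0 x hx)
  simp only [Set.mem_ofPred_eq] at hxn
  linarith

/-- A quadratic form that is nonnegative on the standard simplex is nonnegative on the
nonnegative orthant. -/
theorem Matrix.dotProduct_mulVec_nonneg_of_stdSimplex {n : Type*} [Fintype n] (B : Matrix n n ℝ)
    (h : ∀ v ∈ stdSimplex ℝ n, 0 ≤ v ⬝ᵥ (B *ᵥ v)) (v : n → ℝ) (hv : 0 ≤ v) :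
    0 ≤ v ⬝ᵥ (B *ᵥ v) := by
  rcases (Finset.sum_nonneg fun i _ => hv i : 0 ≤ ∑ i, v i).eq_or_lt with h0 | h0
  · have : v = 0 := by
      ext i
      exact (Finset.sum_eq_zero_iff_of_nonneg fun i _ => hv i).1 h0.symm i (Finset.mem_univ i)
    simp [this]
  · have hmem : (∑ i, v i)⁻¹ • v ∈ stdSimplex ℝ n := by
      refine ⟨fun i => mul_nonneg (inv_nonneg.2 h0.le) (hv i), ?_⟩
      simp only [Pi.smul_apply, smul_eq_mul, ← Finset.mul_sum]
      exact inv_mul_cancel₀ h0.ne'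
    have := h _ hmem
    rw [Matrix.mulVec_smul, smul_dotProduct, dotProduct_smul, smul_eq_mul, smul_eq_mul,
      ← mul_assoc] at this
    exact nonneg_of_mul_nonneg_right this (by positivity)

/-! ### The expanded system and weak duality. -/

namespace RobustQP

variable {D M K J L N : ℕ}

theorem padVector_dotProduct (Q : ℕ) (v : Fin K → ℝ) (χ η : Fin L × Fin Q → ℝ)
    (ξ : Fin K → ℝ) : padVector L Q v ⬝ᵥ Sum.elim χ (Sum.elim η ξ) = v ⬝ᵥ ξ := by
  simp [padVector]

theorem padMatrix_mulVec (Q : ℕ) (B : Matrix (Fin M) (Fin K) ℝ) (χ η : Fin L × Fin Q → ℝ)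
    (ξ : Fin K → ℝ) : padMatrix L Q B *ᵥ Sum.elim χ (Sum.elim η ξ) = B *ᵥ ξ := by
  simp [padMatrix, Matrix.fromCols_mulVec]

theorem expS_mulVec (P : RobustQP ℝ D M K J L N) (Q : ℕ) (χ η : Fin L × Fin Q → ℝ)
    (ξ : Fin K → ℝ) :
    P.expS Q *ᵥ Sum.elim χ (Sum.elim η ξ) =
      Sum.elim (P.S *ᵥ ξ) (Sum.elim
        (fun l => ξ (Fin.castLE P.hL l) - ∑ q : Fin Q, 2 ^ (q : ℕ) * χ (l, q)) (χ + η)) := by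
  simp only [expS, Matrix.fromRows_mulVec, Matrix.fromCols_mulVec, Sum.elim_comp_inl,
    Sum.elim_comp_inr, Matrix.zero_mulVec, zero_add, Matrix.one_mulVec, add_zero]
  congr 2
  ext l
  simp only [Pi.add_apply, Matrix.neg_mulVec, Pi.neg_apply]
  have h1 : (binaryWeights ℝ L Q *ᵥ χ) l = ∑ q : Fin Q, 2 ^ (q : ℕ) * χ (l, q) := by
    simp [Matrix.mulVec, dotProduct, binaryWeights, Fintype.sum_prod_type]
  have h2 : (firstCoords ℝ P.hL *ᵥ ξ) l = ξ (Fin.castLE P.hL l) := by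
    simp [Matrix.mulVec, dotProduct, firstCoords]
  rw [h1, h2]; ring

theorem γ₀_dotProduct {Q : ℕ} (y : CopVars K J L Q) (χ : Fin L × Fin Q → ℝ)
    (w : (Fin L × Fin Q) ⊕ Fin K → ℝ) : y.γ₀ ⬝ᵥ Sum.elim χ w = y.γ ⬝ᵥ χ := by
  simp [CopVars.γ₀]

/-- The quadratic form of the copositive constraint. -/
theorem dotProduct_copMatrix_mulVec (P : RobustQP ℝ D M K J L N) (Q : ℕ) (x : Fin D → ℝ)
    (y : CopVars K J L Q) (z : VarIdx L Q K → ℝ) (s : ℝ) :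
    Sum.elim z (fun _ => s) ⬝ᵥ (P.copMatrix Q x y *ᵥ Sum.elim z fun _ => s) =
      y.φ ⬝ᵥ ((P.expS Q *ᵥ z) * (P.expS Q *ᵥ z)) - z ⬝ᵥ (y.H *ᵥ z) - y.γ₀ ⬝ᵥ (z * z)
        + s * (y.ψ ⬝ᵥ (P.expS Q *ᵥ z) - padVector L Q (P.b x) ⬝ᵥ z + y.γ₀ ⬝ᵥ z)
        + y.τ * s ^ 2 := by
  have h1 : Matrix.replicateCol Unit (P.copColumn Q x y) *ᵥ (fun _ => s)
      = s • P.copColumn Q x y := by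
    ext i; simp [Matrix.mulVec, dotProduct, mul_comm]
  have h2 : Matrix.replicateRow Unit (P.copColumn Q x y) *ᵥ z
      = fun _ => P.copColumn Q x y ⬝ᵥ z := by
    ext i; simp [Matrix.mulVec]
  have h3 : (Matrix.of fun _ _ => y.τ : Matrix Unit Unit ℝ) *ᵥ (fun _ => s) = fun _ => y.τ * s := by
    ext i; simp [Matrix.mulVec, dotProduct]
  have h4 : z ⬝ᵥ (((P.expS Q)ᵀ * Matrix.diagonal y.φ * P.expS Q) *ᵥ z)
      = y.φ ⬝ᵥ ((P.expS Q *ᵥ z) * (P.expS Q *ᵥ z)) := by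
    rw [← Matrix.mulVec_mulVec, ← Matrix.mulVec_mulVec, Matrix.dotProduct_mulVec,
      Matrix.vecMul_transpose]
    simp only [dotProduct, Matrix.mulVec_diagonal, Pi.mul_apply]
    exact Finset.sum_congr rfl fun _ _ => by ring
  have h5 : z ⬝ᵥ (Matrix.diagonal y.γ₀ *ᵥ z) = y.γ₀ ⬝ᵥ (z * z) := by
    simp only [dotProduct, Matrix.mulVec_diagonal, Pi.mul_apply]
    exact Finset.sum_congr rfl fun _ _ => by ring
  have h6 : P.copColumn Q x y ⬝ᵥ z
      = 1 / 2 * (y.ψ ⬝ᵥ (P.expS Q *ᵥ z) - padVector L Q (P.b x) ⬝ᵥ z + y.γ₀ ⬝ᵥ z) := by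
    rw [copColumn, smul_dotProduct, add_dotProduct, sub_dotProduct, Matrix.mulVec_transpose,
      ← Matrix.dotProduct_mulVec, smul_eq_mul]
  have h7 : ∀ a b : Unit → ℝ, a ⬝ᵥ b = a () * b () := fun a b => by simp [dotProduct]
  rw [copMatrix, Matrix.fromBlocks_mulVec, sumElim_dotProduct_sumElim]
  simp only [Sum.elim_comp_inl, Sum.elim_comp_inr]
  rw [h1, h2, h3, dotProduct_add, Matrix.sub_mulVec, Matrix.sub_mulVec, dotProduct_sub,
    dotProduct_sub, h4, h5, dotProduct_smul, dotProduct_comm z (P.copColumn Q x y), h6, h7]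
  simp only [Pi.add_apply, smul_eq_mul]
  ring

/-- The coupling constraint says that `H - 𝒜(x)ᵀ 𝒜(x)` is positive semidefinite. -/
theorem coupling_posSemidef_iff (Q : ℕ) (B : Matrix (Fin M) (Fin K) ℝ)
    (H : Matrix (VarIdx L Q K) (VarIdx L Q K) ℝ) :
    (Matrix.fromBlocks (1 : Matrix (Fin M) (Fin M) ℝ) (padMatrix L Q B)
      (padMatrix L Q B)ᵀ H).PosSemidef ↔
      (H - (padMatrix L Q B)ᵀ * padMatrix L Q B).PosSemidef := by
  have : Invertible (1 : Matrix (Fin M) (Fin M) ℝ) := invertibleOne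
  have := Matrix.PosDef.fromBlocks₁₁ (padMatrix L Q B) H
    (Matrix.PosDef.one : (1 : Matrix (Fin M) (Fin M) ℝ).PosDef)
  simpa [Matrix.conjTranspose_eq_transpose_of_trivial] using this

theorem dotProduct_transpose_mul_self_mulVec {m n : Type*} [Fintype m] [Fintype n]
    (B : Matrix m n ℝ) (z : n → ℝ) : z ⬝ᵥ ((Bᵀ * B) *ᵥ z) = ‖WithLp.toLp 2 (B *ᵥ z)‖ ^ 2 := by
  rw [← Matrix.mulVec_mulVec, Matrix.dotProduct_mulVec, Matrix.vecMul_transpose,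
    EuclideanSpace.real_norm_sq_eq]
  simp [dotProduct, sq]

/-- Bounded mixed-integer sets have no nonzero recession direction with integer
coordinates in the integer positions. -/
theorem recession_eq_zero (P : RobustQP ℝ D M K J L N) (hne : P.uncertaintySet.Nonempty)
    (hbd : Bornology.IsBounded P.uncertaintySet) (d : Fin K → ℝ) (hd : 0 ≤ d)
    (hS : P.S *ᵥ d = 0) (hint : ∀ l : Fin L, ∃ z : ℤ, d (Fin.castLE P.hL l) = z) : d = 0 := by
  obtain ⟨ξ, h0, ht, hz⟩ := hne
  have hmem : ∀ n : ℕ, ξ + (n : ℝ) • d ∈ P.uncertaintySet := by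
    refine fun n => ⟨add_nonneg h0 (smul_nonneg n.cast_nonneg hd), ?_, fun l => ?_⟩
    · rw [Matrix.mulVec_add, Matrix.mulVec_smul, hS, ht]; simp
    · obtain ⟨a, ha⟩ := hz l
      obtain ⟨b, hb⟩ := hint l
      exact ⟨a + n * b, by simp [ha, hb]⟩
  obtain ⟨C, hC⟩ := hbd.exists_norm_le
  ext k
  by_contra hk
  have hk : 0 < d k := lt_of_le_of_ne (hd k) (Ne.symm hk)
  obtain ⟨n, hn⟩ := exists_nat_gt (C / d k)
  rw [div_lt_iff₀ hk] at hn
  have h1 := (norm_le_pi_norm _ k).trans (hC _ (hmem n))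
  rw [Real.norm_eq_abs] at h1
  have h2 := le_of_abs_le h1
  simp only [Pi.add_apply, Pi.smul_apply, smul_eq_mul] at h2
  have := h0 k
  simp only [Pi.zero_apply] at this
  linarith

/-- The rows `χ + η = 0` kill `χ` and `η`, and the binary rows then force `ξ_l = 0` for `l < L`.
Hence `ξ` is a recession direction that is integral, namely zero, in the integer positions, and this
is what `recession_eq_zero` excludes. The continuous relaxation itself may be unbounded when the
data are irrational. -/
theorem eq_zero_of_expS_mulVec_eq_zero (P : RobustQP ℝ D M K J L N)
    (hne : P.uncertaintySet.Nonempty) (hbd : Bornology.IsBounded P.uncertaintySet) (Q : ℕ)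
    (z : VarIdx L Q K → ℝ) (hz : 0 ≤ z) (h : P.expS Q *ᵥ z = 0) : z = 0 := by
  obtain ⟨χ, w, rfl⟩ : ∃ χ w, z = Sum.elim χ w := ⟨_, _, (Sum.elim_comp_inl_inr z).symm⟩
  obtain ⟨η, ξ, rfl⟩ : ∃ η ξ, w = Sum.elim η ξ := ⟨_, _, (Sum.elim_comp_inl_inr w).symm⟩
  rw [expS_mulVec] at h
  have hχη : ∀ p, χ p + η p = 0 := fun p => congrFun h (Sum.inr (Sum.inr p))
  have hχ0 : ∀ p, 0 ≤ χ p := fun p => hz (Sum.inl p)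
  have hη0 : ∀ p, 0 ≤ η p := fun p => hz (Sum.inr (Sum.inl p))
  have hχ : χ = 0 := by ext p; have := hχη p; have := hχ0 p; have := hη0 p; simp; linarith
  have hη : η = 0 := by ext p; have := hχη p; have := hχ0 p; have := hη0 p; simp; linarith
  have hξ : ξ = 0 := by
    refine P.recession_eq_zero hne hbd ξ (fun k => hz (Sum.inr (Sum.inr k)))
      (funext fun j => congrFun h (Sum.inl j)) fun l => ⟨0, ?_⟩
    have := congrFun h (Sum.inr (Sum.inl l))
    simpa [hχ] using this
  rw [hχ, hη, hξ]
  ext i; rcases i with i | i | i <;> rfl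

theorem exists_isBitBound (P : RobustQP ℝ D M K J L N)
    (hbd : Bornology.IsBounded P.uncertaintySet) : ∃ Q : ℕ, P.IsBitBound Q := by
  obtain ⟨C, hC⟩ := hbd.exists_norm_le
  obtain ⟨Q, hQ⟩ := pow_unbounded_of_one_lt (C + 1) (one_lt_two (α := ℝ))
  refine ⟨Q, fun ξ hξ l => ?_⟩
  have := le_of_abs_le ((norm_le_pi_norm _ (Fin.castLE P.hL l)).trans (hC _ hξ))
  linarith

/-- Every point of the uncertainty set lifts to a point of the expanded system with binary
`χ`. -/
theorem exists_lift (P : RobustQP ℝ D M K J L N) {Q : ℕ} (hQ : P.IsBitBound Q)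
    {ξ : Fin K → ℝ} (hξ : ξ ∈ P.uncertaintySet) :
    ∃ χ η : Fin L × Fin Q → ℝ, 0 ≤ χ ∧ 0 ≤ η ∧ χ * χ = χ ∧
      P.expS Q *ᵥ Sum.elim χ (Sum.elim η ξ) = P.expT Q := by
  have hnat : ∀ l : Fin L, ∃ n : ℕ, ξ (Fin.castLE P.hL l) = n := by
    intro l
    obtain ⟨z, hz⟩ := hξ.2.2 l
    have h0 : (0 : ℝ) ≤ z := hz ▸ hξ.1 _
    lift z to ℕ using by exact_mod_cast h0
    exact ⟨z, by simpa using hz⟩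
  choose n hn using hnat
  have hlt : ∀ l, n l < 2 ^ Q := fun l => by
    have h := hQ ξ hξ l
    rw [hn] at h
    have : (n l : ℝ) < 2 ^ Q := by linarith
    exact_mod_cast this
  let χ : Fin L × Fin Q → ℝ := fun p => if (n p.1).testBit p.2 then 1 else 0
  have hχ : ∀ p, χ p = 0 ∨ χ p = 1 := fun p => by
    by_cases h : (n p.1).testBit p.2 <;> simp [χ, h]
  refine ⟨χ, 1 - χ, fun p => ?_, fun p => ?_, ?_, ?_⟩
  · rcases hχ p with h | h <;> simp [h]
  · rcases hχ p with h | h <;> simp [h]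
  · ext p
    rcases hχ p with h | h <;> simp [h]
  · rw [expS_mulVec, hξ.2.1, expT]
    congr 2
    · ext l
      have := sum_two_pow_mul_testBit Q (n l) (hlt l)
      simp only [Pi.zero_apply, hn, sub_eq_zero, χ]
      exact_mod_cast this.symm
    · simp

/-- Weak duality. -/
theorem le_copObjective (P : RobustQP ℝ D M K J L N) {Q : ℕ} (hQ : P.IsBitBound Q)
    {x : Fin D → ℝ} {y : CopVars K J L Q} (hy : P.IsCopFeasible Q x y)
    {ξ : Fin K → ℝ} (hξ : ξ ∈ P.uncertaintySet) :
    ‖WithLp.toLp 2 (P.A x *ᵥ ξ)‖ ^ 2 + P.b x ⬝ᵥ ξ + P.c x ≤ P.copObjective Q x y := by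
  obtain ⟨χ, η, hχ, hη, hbin, hS⟩ := P.exists_lift hQ hξ
  obtain ⟨-, -, hH, -, hcop⟩ := hy
  rw [coupling_posSemidef_iff] at hH
  have h1 := hH.dotProduct_mulVec_nonneg (Sum.elim χ (Sum.elim η ξ))
  rw [star_trivial, Matrix.sub_mulVec, dotProduct_sub, dotProduct_transpose_mul_self_mulVec,
    padMatrix_mulVec] at h1
  have h2 := hcop (Sum.elim (Sum.elim χ (Sum.elim η ξ)) fun _ => 1) (by
    rintro ((i | i | i) | i)
    exacts [hχ i, hη i, hξ.1 i, zero_le_one])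
  -- For binary `χ` the quadratic and the linear terms in `γ` cancel.
  have h3 : y.γ₀ ⬝ᵥ (Sum.elim χ (Sum.elim η ξ) * Sum.elim χ (Sum.elim η ξ)) = y.γ ⬝ᵥ χ := by
    rw [← Sum.elim_mul_mul, γ₀_dotProduct, hbin]
  rw [dotProduct_copMatrix_mulVec, hS, h3, γ₀_dotProduct, padVector_dotProduct] at h2
  rw [copObjective, dotProduct_comm (P.expT Q) y.ψ, dotProduct_comm (_ * _) y.φ]
  linarith

end RobustQP

/-! ### Strong duality and equivalence of the two programs. -/

namespace RobustQP

variable {D M K J L N : ℕ}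

/-- A nonzero nonnegative solution of the homogenized expanded system with `χ ∈ {0, s}` is, up
to scaling, a point of the uncertainty set. -/
theorem smul_mem_uncertaintySet (P : RobustQP ℝ D M K J L N) {Q : ℕ}
    {χ η : Fin L × Fin Q → ℝ} {ξ : Fin K → ℝ} {s : ℝ} (hs : 0 < s) (hξ : 0 ≤ ξ)
    (hχ : ∀ p, χ p = 0 ∨ χ p = s)
    (h : P.expS Q *ᵥ Sum.elim χ (Sum.elim η ξ) = s • P.expT Q) :
    s⁻¹ • ξ ∈ P.uncertaintySet := by
  rw [expS_mulVec] at h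
  refine ⟨smul_nonneg (inv_nonneg.2 hs.le) hξ, ?_, fun l => ?_⟩
  · have : P.S *ᵥ ξ = s • P.t := funext fun j => congrFun h (Sum.inl j)
    rw [Matrix.mulVec_smul, this, smul_smul, inv_mul_cancel₀ hs.ne', one_smul]
  · have h1 : ∀ p, ∃ a : ℤ, s⁻¹ * χ p = a := fun p => by
      rcases hχ p with h | h
      · exact ⟨0, by simp [h]⟩
      · exact ⟨1, by simp [h, hs.ne']⟩
    choose a ha using h1
    have h2 := congrFun h (Sum.inr (Sum.inl l))
    simp only [Sum.elim_inr, Sum.elim_inl, Pi.smul_apply, expT, Pi.zero_apply, smul_zero,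
      sub_eq_zero] at h2
    refine ⟨∑ q : Fin Q, 2 ^ (q : ℕ) * a (l, q), ?_⟩
    rw [Pi.smul_apply, h2, smul_eq_mul, Finset.mul_sum]
    push_cast
    exact Finset.sum_congr rfl fun q _ => by rw [← ha]; ring

/-- Strong duality: every number that strictly exceeds the cost of all scenarios is the objective
value of a feasible point of the copositive program. -/
theorem exists_isCopFeasible (P : RobustQP ℝ D M K J L N) (hne : P.uncertaintySet.Nonempty)
    (hbd : Bornology.IsBounded P.uncertaintySet) (Q : ℕ) {x : Fin D → ℝ} (hx : x ∈ P.X) {r : ℝ}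
    (hr : ∀ ξ ∈ P.uncertaintySet,
      ‖WithLp.toLp 2 (P.A x *ᵥ ξ)‖ ^ 2 + P.b x ⬝ᵥ ξ + P.c x < r) :
    ∃ y : CopVars K J L Q, P.IsCopFeasible Q x y ∧ P.copObjective Q x y = r := by
  -- The smallest `H` allowed by the coupling constraint. With the last coordinate of `v` as `s`,
  -- `f` is `s²` times the gap between `r` and the cost at `ξ / s`, `g` homogenizes `∑ χ (1 - χ)`,
  -- and `e` is the residual of the homogenized system.
  let H : Matrix (VarIdx L Q K) (VarIdx L Q K) ℝ := (padMatrix L Q (P.A x))ᵀ * padMatrix L Q (P.A x)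
  let f : (VarIdx L Q K ⊕ Unit → ℝ) → ℝ := fun v =>
    (r - P.c x) * v (Sum.inr ()) ^ 2 - (v ∘ Sum.inl) ⬝ᵥ (H *ᵥ (v ∘ Sum.inl))
      - v (Sum.inr ()) * (padVector L Q (P.b x) ⬝ᵥ (v ∘ Sum.inl))
  let g : (VarIdx L Q K ⊕ Unit → ℝ) → ℝ := fun v =>
    ∑ p : Fin L × Fin Q, v (Sum.inl (Sum.inl p)) * (v (Sum.inr ()) - v (Sum.inl (Sum.inl p)))
  let e : (VarIdx L Q K ⊕ Unit → ℝ) → RowIdx L Q J → ℝ := fun v =>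
    P.expS Q *ᵥ (v ∘ Sum.inl) - v (Sum.inr ()) • P.expT Q
  have hcl : Continuous fun v : VarIdx L Q K ⊕ Unit → ℝ => v ∘ Sum.inl := by fun_prop
  have hf : Continuous f := by
    have h1 := hcl.dotProduct (Continuous.matrix_mulVec (continuous_const (y := H)) hcl)
    have h2 := (continuous_const (y := padVector L Q (P.b x))).dotProduct hcl
    exact (by fun_prop : Continuous fun v : VarIdx L Q K ⊕ Unit → ℝ =>
      (r - P.c x) * v (Sum.inr ()) ^ 2).sub h1 |>.sub ((continuous_apply _).mul h2)
  have hg : Continuous g := by fun_prop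
  have he : Continuous e :=
    (Continuous.matrix_mulVec continuous_const hcl).sub ((continuous_apply _).smul continuous_const)
  have he2 : Continuous fun v => e v ⬝ᵥ e v := he.dotProduct he
  -- Where `e` vanishes, `s - χ = η ≥ 0`, so every term of `g` is nonnegative, and `g = 0` means `χ
  -- ∈ {0, s}` in each coordinate.
  have hzero : ∀ v ∈ stdSimplex ℝ (VarIdx L Q K ⊕ Unit), e v = 0 →
      0 ≤ g v ∧ (g v = 0 → 0 < f v) := by
    intro v hv hev
    obtain ⟨z, w, rfl⟩ : ∃ z w, v = Sum.elim z w := ⟨_, _, (Sum.elim_comp_inl_inr v).symm⟩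
    obtain ⟨χ, w', rfl⟩ : ∃ χ w, z = Sum.elim χ w := ⟨_, _, (Sum.elim_comp_inl_inr z).symm⟩
    obtain ⟨η, ξ, rfl⟩ : ∃ η ξ, w' = Sum.elim η ξ := ⟨_, _, (Sum.elim_comp_inl_inr w').symm⟩
    have hS : P.expS Q *ᵥ Sum.elim χ (Sum.elim η ξ) = w () • P.expT Q := sub_eq_zero.1 hev
    have hχ0 : ∀ p, 0 ≤ χ p := fun p => hv.1 (Sum.inl (Sum.inl p))
    have hη0 : ∀ p, 0 ≤ η p := fun p => hv.1 (Sum.inl (Sum.inr (Sum.inl p)))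
    have hξ0 : 0 ≤ ξ := fun k => hv.1 (Sum.inl (Sum.inr (Sum.inr k)))
    have hχη : ∀ p, χ p + η p = w () := by
      intro p
      have := congrFun hS (Sum.inr (Sum.inr p))
      rw [expS_mulVec] at this
      simpa [expT] using this
    have hterm : ∀ p, 0 ≤ χ p * (w () - χ p) := fun p =>
      mul_nonneg (hχ0 p) (by linarith [hχη p, hη0 p])
    refine ⟨Finset.sum_nonneg fun p _ => hterm p, fun hg0 => ?_⟩
    -- If `s = 0`, then `z` solves the homogeneous system and vanishes, against the coordinate sum
    -- `1`.
    have hw : 0 < w () := by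
      refine lt_of_le_of_ne (hv.1 (Sum.inr ())) fun h0 => ?_
      rw [← h0, zero_smul] at hS
      have hz := P.eq_zero_of_expS_mulVec_eq_zero hne hbd Q (Sum.elim χ (Sum.elim η ξ))
        (fun i => hv.1 (Sum.inl i)) hS
      have hsum := hv.2
      rw [hz] at hsum
      simp [← h0] at hsum
    have hmem := P.smul_mem_uncertaintySet (η := η) hw hξ0 (fun p => by
      have := (Finset.sum_eq_zero_iff_of_nonneg fun p _ => hterm p).1 hg0 p (Finset.mem_univ p)
      rcases mul_eq_zero.1 this with h | h
      · exact Or.inl h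
      · exact Or.inr (sub_eq_zero.1 h).symm) hS
    have h1 := hr _ hmem
    rw [Matrix.mulVec_smul, WithLp.toLp_smul, norm_smul, dotProduct_smul, mul_pow, norm_inv,
      Real.norm_eq_abs, inv_pow, sq_abs, smul_eq_mul] at h1
    have h2 : f (Sum.elim (Sum.elim χ (Sum.elim η ξ)) w) = (r - P.c x) * w () ^ 2
        - ‖WithLp.toLp 2 (P.A x *ᵥ ξ)‖ ^ 2 - w () * (P.b x ⬝ᵥ ξ) := by
      simp only [f, H, Sum.elim_comp_inl, Sum.elim_inr]
      rw [dotProduct_transpose_mul_self_mulVec, padMatrix_mulVec, padVector_dotProduct]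
    have h3 : f (Sum.elim (Sum.elim χ (Sum.elim η ξ)) w) = w () ^ 2 *
        (r - ((w () ^ 2)⁻¹ * ‖WithLp.toLp 2 (P.A x *ᵥ ξ)‖ ^ 2 + (w ())⁻¹ * P.b x ⬝ᵥ ξ + P.c x)) := by
      rw [h2]; field_simp; ring
    rw [h3]
    exact mul_pos (by positivity) (sub_pos.2 h1)
  have hK := isCompact_stdSimplex ℝ (VarIdx L Q K ⊕ Unit)
  -- The order of the penalties matters: nonnegativity of `g` is known only where `e = 0`, so `σ` is
  -- found on that compact slice. Then `ρ` penalizes `‖e‖²`, which is nonnegative everywhere.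
  obtain ⟨σ, -, hσ⟩ := (hK.inter_right (isClosed_eq he continuous_const)).exists_pos_add_mul
    hf hg (fun v hv => (hzero v hv.1 hv.2).1) (fun v hv => (hzero v hv.1 hv.2).2)
  obtain ⟨ρ, -, hρ⟩ := hK.exists_pos_add_mul (hf.add (continuous_const.mul hg)) he2
    (fun v _ => Finset.sum_nonneg fun i _ => mul_self_nonneg _)
    (fun v hv h => hσ v ⟨hv, dotProduct_self_eq_zero.1 h⟩)
  have hH : H.PosSemidef := by
    simpa [H, Matrix.conjTranspose_eq_transpose_of_trivial] using
      Matrix.posSemidef_conjTranspose_mul_self (padMatrix L Q (P.A x))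
  -- The multipliers are read off from `f + σ g + ρ ‖e‖²`: expanding `ρ ‖𝒮 z - s 𝓉‖²` gives `φ`, `ψ`
  -- and the first part of `τ`, while `σ g` gives `γ`.
  let y : CopVars K J L Q :=
    { τ := ρ * (P.expT Q ⬝ᵥ P.expT Q) + (r - P.c x)
      ψ := (-2 * ρ) • P.expT Q
      φ := fun _ => ρ
      γ := fun _ => σ
      H := H }
  have hφ : ∀ u : RowIdx L Q J → ℝ, y.φ ⬝ᵥ (u * u) = ρ * (u ⬝ᵥ u) := fun u => by
    simp only [y, dotProduct, Finset.mul_sum, Pi.mul_apply]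
  refine ⟨y, ⟨hx, hH, ?_, ?_, ?_⟩, ?_⟩
  · rw [coupling_posSemidef_iff]
    simp only [y, H, sub_self]
    exact Matrix.PosSemidef.zero
  · have hHT : Hᵀ = H := by simp [H, Matrix.transpose_mul]
    rw [Matrix.IsSymm, copMatrix, Matrix.fromBlocks_transpose]
    congr 1
    simp only [Matrix.transpose_sub, Matrix.transpose_mul, Matrix.transpose_transpose,
      Matrix.diagonal_transpose, y, hHT, Matrix.mul_assoc]
  · refine Matrix.dotProduct_mulVec_nonneg_of_stdSimplex _ fun v hv => (hρ v hv).le.trans_eq ?_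
    obtain ⟨z, w, rfl⟩ : ∃ z w, v = Sum.elim z w := ⟨_, _, (Sum.elim_comp_inl_inr v).symm⟩
    have hγ : y.γ₀ ⬝ᵥ (z * z) = σ * ∑ p, z (Sum.inl p) * z (Sum.inl p) := by
      simp [CopVars.γ₀, y, dotProduct, Finset.mul_sum]
    have hγ' : y.γ₀ ⬝ᵥ z = σ * ∑ p, z (Sum.inl p) := by
      simp [CopVars.γ₀, y, dotProduct, Finset.mul_sum]
    have hgz : g (Sum.elim z w) = w () * ∑ p, z (Sum.inl p)
        - ∑ p, z (Sum.inl p) * z (Sum.inl p) := by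
      simp only [g, Sum.elim_inl, Sum.elim_inr, Finset.mul_sum, ← Finset.sum_sub_distrib]
      exact Finset.sum_congr rfl fun _ _ => by ring
    have hw : w = fun _ => w () := rfl
    rw [hw, dotProduct_copMatrix_mulVec, ← hw, hφ, hγ, hγ', Pi.add_apply, Pi.mul_apply, hgz]
    simp only [f, e, y, Sum.elim_comp_inl, Sum.elim_inr, dotProduct_sub, sub_dotProduct,
      smul_dotProduct, dotProduct_smul, smul_eq_mul]
    rw [dotProduct_comm (P.expS Q *ᵥ z) (P.expT Q)]
    ring
  -- The multiples `-2ρ`, `ρ` and `ρ` of `‖𝓉‖²` cancel, leaving `r`.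
  · rw [copObjective, dotProduct_comm _ y.φ, hφ]
    simp only [y, dotProduct_smul, smul_eq_mul]
    ring

/-- The infimum need not be attained: strong duality realizes each real number strictly above the
worst case as an objective value, and these numbers approach it. -/
theorem worstCase_eq_copSectionValue (P : RobustQP ℝ D M K J L N)
    (hne : P.uncertaintySet.Nonempty) (hbd : Bornology.IsBounded P.uncertaintySet) {Q : ℕ}
    (hQ : P.IsBitBound Q) {x : Fin D → ℝ} (hx : x ∈ P.X) :
    P.worstCase x = P.copSectionValue Q x := by
  apply le_antisymm
  · exact le_iInf₂ fun y hy => iSup₂_le fun ξ hξ =>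
      EReal.coe_le_coe_iff.2 (P.le_copObjective hQ hy hξ)
  · refine le_of_forall_gt_imp_ge_of_dense fun a ha => ?_
    obtain ⟨r, hr, hra⟩ := EReal.lt_iff_exists_real_btwn.1 ha
    obtain ⟨y, hy, hyr⟩ := P.exists_isCopFeasible hne hbd Q hx (r := r) fun ξ hξ =>
      EReal.coe_lt_coe_iff.1 (lt_of_le_of_lt (le_iSup₂_of_le ξ hξ le_rfl) hr)
    exact (iInf₂_le y hy).trans (by rw [hyr]; exact hra.le)

theorem copValue_eq_iInf_copSectionValue (P : RobustQP ℝ D M K J L N) (Q : ℕ) :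
    P.copValue Q = ⨅ x ∈ P.X, P.copSectionValue Q x := by
  apply le_antisymm
  · exact le_iInf₂ fun x _ => iInf_le _ x
  · exact le_iInf fun x => le_iInf₂ fun y hy =>
      (iInf₂_le x hy.1).trans (iInf₂_le y hy)

theorem robustValue_eq_copValue (P : RobustQP ℝ D M K J L N)
    (hne : P.uncertaintySet.Nonempty) (hbd : Bornology.IsBounded P.uncertaintySet) {Q : ℕ}
    (hQ : P.IsBitBound Q) : P.robustValue = P.copValue Q := by
  rw [copValue_eq_iInf_copSectionValue, robustValue]
  exact iInf_congr fun x => iInf_congr fun hx => P.worstCase_eq_copSectionValue hne hbd hQ hx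

theorem isRobustOptimal_iff (P : RobustQP ℝ D M K J L N)
    (hne : P.uncertaintySet.Nonempty) (hbd : Bornology.IsBounded P.uncertaintySet) {Q : ℕ}
    (hQ : P.IsBitBound Q) {x : Fin D → ℝ} (hx : x ∈ P.X) :
    P.IsRobustOptimal x ↔ P.copSectionValue Q x = P.copValue Q := by
  rw [← P.worstCase_eq_copSectionValue hne hbd hQ hx, ← P.robustValue_eq_copValue hne hbd hQ]
  constructor
  · exact fun h => le_antisymm (le_iInf₂ h.2) (iInf₂_le x hx)
  · exact fun h => ⟨hx, fun x' hx' => h.le.trans (iInf₂_le x' hx')⟩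

/-- Section value, objective at `y` and global value form a closed chain of inequalities, hence
coincide. -/
theorem IsCopOptimal.isRobustOptimal {P : RobustQP ℝ D M K J L N}
    (hne : P.uncertaintySet.Nonempty) (hbd : Bornology.IsBounded P.uncertaintySet) {Q : ℕ}
    (hQ : P.IsBitBound Q) {x : Fin D → ℝ} {y : CopVars K J L Q} (h : P.IsCopOptimal Q x y) :
    P.IsRobustOptimal x ∧ P.worstCase x = (P.copObjective Q x y : EReal) := by
  have hx := h.1.1
  have h1 : P.copSectionValue Q x ≤ P.copObjective Q x y := iInf₂_le y h.1
  have h2 : (P.copObjective Q x y : EReal) ≤ P.copValue Q :=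
    le_iInf fun x' => le_iInf₂ fun y' hy' => EReal.coe_le_coe_iff.2 (h.2 x' y' hy')
  have h3 : P.copValue Q ≤ P.copSectionValue Q x := iInf_le _ x
  exact ⟨(P.isRobustOptimal_iff hne hbd hQ hx).2 (le_antisymm (h1.trans h2) h3),
    (P.worstCase_eq_copSectionValue hne hbd hQ hx).trans (le_antisymm h1 (h2.trans h3))⟩

end RobustQP

/-! ### Rational kernel vectors and bounds on basic solutions. -/

/-- A rational homogeneous linear system with a nonzero nonnegative real solution has a nonzero
nonnegative rational solution. -/
theorem Matrix.exists_rat_mulVec_eq_zero {m n : Type*} [Fintype n]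
    (S : Matrix m n ℚ) {d : n → ℝ} (hd : 0 ≤ d) (hd0 : d ≠ 0)
    (hS : S.map (fun r => (r : ℝ)) *ᵥ d = 0) : ∃ a : n → ℚ, 0 ≤ a ∧ a ≠ 0 ∧ S *ᵥ a = 0 := by
  -- The coordinates of `d` span a finite-dimensional `ℚ`-subspace of `ℝ`. A `ℚ`-linear map `W → ℚ`
  -- preserves all rational relations among them, in particular `S d = 0`; it remains to choose one
  -- that keeps positive coordinates positive.
  let W := Submodule.span ℚ (Set.range d)
  have : FiniteDimensional ℚ W := FiniteDimensional.span_of_finite ℚ (Set.finite_range d)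
  let B := Module.finBasis ℚ W
  let w : n → W := fun k => ⟨d k, Submodule.subset_span ⟨k, rfl⟩⟩
  have hdk : ∀ k, d k = ∑ i, (B.repr (w k) i : ℝ) * (B i : ℝ) := fun k => by
    rw [show d k = ((w k : W) : ℝ) from rfl]
    conv_lhs => rw [← B.sum_repr (w k)]
    simp only [Submodule.coe_sum, Submodule.coe_smul, Rat.smul_def]
  -- The admissible values on the basis form an open set containing the real values of the basis
  -- vectors themselves, so it contains a rational point.
  let U : Set (Fin (Module.finrank ℚ W) → ℝ) :=
    {r | ∀ k, 0 < d k → 0 < ∑ i, (B.repr (w k) i : ℝ) * r i}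
  have hU : IsOpen U := by
    simp only [U, Set.ofPred_forall]
    refine isOpen_iInter_of_finite fun k => isOpen_iInter_of_finite fun _ => ?_
    exact isOpen_lt continuous_const (by fun_prop)
  have hdense : DenseRange (Pi.map fun (_ : Fin (Module.finrank ℚ W)) (q : ℚ) => (q : ℝ)) :=
    DenseRange.piMap fun _ => Rat.denseRange_cast
  obtain ⟨r, hr⟩ := hdense.exists_mem_open hU ⟨fun i => (B i : ℝ), fun k hk => (hdk k) ▸ hk⟩
  let f : W →ₗ[ℚ] ℚ := B.constr ℚ r
  have hf : ∀ k, ((f (w k) : ℚ) : ℝ) = ∑ i, (B.repr (w k) i : ℝ) * r i := fun k => by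
    simp [f, Module.Basis.constr_apply_fintype]
  have hpos : ∀ k, 0 < d k → 0 < f (w k) := fun k hk => by
    have := hr k hk
    simp only [Pi.map_apply] at this
    rw [← hf] at this
    exact_mod_cast this
  have hzero : ∀ k, d k = 0 → f (w k) = 0 := fun k hk => by
    rw [show w k = 0 from Subtype.ext hk, map_zero]
  refine ⟨fun k => f (w k), fun k => ?_, fun h => hd0 ?_, ?_⟩
  · rcases (hd k).eq_or_lt with h | h
    · exact (hzero k h.symm).ge
    · exact (hpos k h).le
  · ext k
    by_contra hk
    exact (hpos k (lt_of_le_of_ne (hd k) (Ne.symm hk))).ne' (congrFun h k)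
  · ext j
    have h0 : ∑ k, S j k • w k = 0 := by
      apply Subtype.ext
      have := congrFun hS j
      simpa [Matrix.mulVec, dotProduct, w, Rat.smul_def] using this
    have := congrArg f h0
    simpa [Matrix.mulVec, dotProduct] using this

/-- If `S d = 0`, `d ≥ 0` has only the trivial solution, then every nonnegative `ξ` can be moved to
a basic solution of the same system without decreasing a given coordinate. -/
theorem Matrix.exists_basic_solution_ge {m n : Type*} [Fintype n]
    (S : Matrix m n ℝ) (htriv : ∀ d : n → ℝ, 0 ≤ d → S *ᵥ d = 0 → d = 0) (l : n)
    (ξ : n → ℝ) (hξ : 0 ≤ ξ) :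
    ∃ ζ : n → ℝ, 0 ≤ ζ ∧ S *ᵥ ζ = S *ᵥ ξ ∧ ξ l ≤ ζ l ∧
      ∀ d : n → ℝ, (∀ k, ζ k = 0 → d k = 0) → S *ᵥ d = 0 → d = 0 := by
  classical
  induction hc : (Finset.univ.filter fun k => ξ k ≠ 0).card using Nat.strong_induction_on
    generalizing ξ with
  | _ c ih =>
    by_cases hb : ∀ d : n → ℝ, (∀ k, ξ k = 0 → d k = 0) → S *ᵥ d = 0 → d = 0
    · exact ⟨ξ, hξ, rfl, le_rfl, hb⟩
    push Not at hb
    obtain ⟨d, hsupp, hSd, hd0, hdl⟩ : ∃ d : n → ℝ,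
        (∀ k, ξ k = 0 → d k = 0) ∧ S *ᵥ d = 0 ∧ d ≠ 0 ∧ 0 ≤ d l := by
      obtain ⟨d, h1, h2, h3⟩ := hb
      rcases le_total 0 (d l) with h | h
      · exact ⟨d, h1, h2, h3, h⟩
      · exact ⟨-d, fun k hk => by simp [h1 k hk], by rw [Matrix.mulVec_neg, h2, neg_zero],
          neg_ne_zero.2 h3, by simpa using h⟩
    -- A kernel direction without negative coordinates would vanish by `htriv`, so moving along `d`
    -- must eventually reach the boundary of the orthant.
    have hneg : (Finset.univ.filter fun k => d k < 0).Nonempty := by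
      by_contra h
      rw [Finset.not_nonempty_iff_eq_empty, Finset.filter_eq_empty_iff] at h
      exact hd0 (htriv d (fun k => not_lt.1 (h (Finset.mem_univ k))) hSd)
    -- Ratio test: the longest step that preserves nonnegativity. It makes coordinate `k₀` zero and,
    -- as `d` lives on the support of `ξ`, makes no zero coordinate nonzero, so the support shrinks.
    -- Coordinate `l` does not decrease because `d l ≥ 0`.
    obtain ⟨k₀, hk₀, hmin⟩ := Finset.exists_min_image _ (fun k => ξ k / -d k) hneg
    simp only [Finset.mem_filter, Finset.mem_univ, true_and] at hk₀ hmin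
    set a := ξ k₀ / -d k₀ with ha
    have ha0 : 0 ≤ a := div_nonneg (hξ k₀) (by linarith)
    have hξ' : 0 ≤ ξ + a • d := by
      intro k
      have h0 := hξ k
      simp only [Pi.zero_apply, Pi.add_apply, Pi.smul_apply, smul_eq_mul] at h0 ⊢
      rcases le_or_gt 0 (d k) with h | h
      · positivity
      · have := hmin k h
        rw [le_div_iff₀ (by linarith)] at this
        linarith
    have hzero : ξ k₀ + a * d k₀ = 0 := by rw [ha]; field_simp [hk₀.ne]; ring
    obtain ⟨ζ, h1, h2, h3, h4⟩ := ih _ (by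
      rw [← hc]
      refine Finset.card_lt_card (Finset.ssubset_iff_of_subset (fun k hk => ?_) |>.2 ⟨k₀, ?_, ?_⟩)
      · simp only [Finset.mem_filter, Finset.mem_univ, true_and] at hk ⊢
        exact fun h => hk (by simp [h, hsupp k h])
      · simp only [Finset.mem_filter, Finset.mem_univ, true_and]
        exact fun h => hk₀.ne (hsupp _ h)
      · simpa using hzero) (ξ + a • d) hξ' rfl
    refine ⟨ζ, h1, ?_, ?_, h4⟩
    · rw [h2, Matrix.mulVec_add, Matrix.mulVec_smul, hSd, smul_zero, add_zero]
    · refine le_trans ?_ h3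
      simp only [Pi.add_apply, Pi.smul_apply, smul_eq_mul]
      nlinarith

/-- The coordinates of a solution of an integer linear system with a nonsingular square matrix
are bounded in terms of the entries. -/
theorem Matrix.abs_le_of_mulVec_eq {n : Type*} [Fintype n] [DecidableEq n] (A : Matrix n n ℤ)
    (v : n → ℤ) {X : ℤ} (hA : ∀ i j, |A i j| ≤ X) (hv : ∀ i, |v i| ≤ X) (hdet : A.det ≠ 0)
    {ξ : n → ℝ} (h : A.map (fun z => (z : ℝ)) *ᵥ ξ = fun i => (v i : ℝ)) (k : n) :
    |ξ k| ≤ ((Fintype.card n).factorial * X ^ Fintype.card n : ℤ) := by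
  -- Cramer's rule: the numerator is bounded by the Leibniz expansion, and the nonzero integer
  -- denominator has absolute value at least `1`.
  have h1 : (A.det : ℝ) * ξ k = (A.cramer v k : ℤ) := by
    have h2 := congrArg (fun u => (A.map (fun z => (z : ℝ))).adjugate *ᵥ u) h
    simp only [Matrix.mulVec_mulVec, Matrix.adjugate_mul, Matrix.smul_mulVec, Matrix.one_mulVec] at h2
    have h3 := congrFun h2 k
    have h4 : (A.map (fun z => (z : ℝ))).det = A.det := ((Int.castRingHom ℝ).map_det A).symm
    have h5 : (A.map (fun z => (z : ℝ))).adjugate = A.adjugate.map (fun z => (z : ℝ)) :=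
      ((Int.castRingHom ℝ).map_adjugate A).symm
    rw [Pi.smul_apply, smul_eq_mul, h4, h5] at h3
    rw [h3, Matrix.cramer_eq_adjugate_mulVec]
    simp [Matrix.mulVec, dotProduct]
  have h2 : |A.cramer v k| ≤ (Fintype.card n).factorial * X ^ Fintype.card n := by
    rw [Matrix.cramer_apply]
    have := Matrix.det_le (A := A.updateCol k v) (abv := AbsoluteValue.abs) (x := X) fun i j => by
      rw [Matrix.updateCol_apply]
      split_ifs
      · exact hv i
      · exact hA i j
    simpa using this
  have h3 : (1 : ℝ) ≤ |(A.det : ℝ)| := by exact_mod_cast Int.one_le_abs hdet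
  calc |ξ k| ≤ |(A.det : ℝ)| * |ξ k| := le_mul_of_one_le_left (abs_nonneg _) h3
    _ = ((|A.cramer v k| : ℤ) : ℝ) := by rw [← abs_mul, h1]; simp
    _ ≤ _ := by exact_mod_cast h2

/-- The coordinates of a basic solution of an integer linear system are bounded in terms of the
number of equations and unknowns and of the entries. -/
theorem Matrix.abs_le_of_basic_solution {m n : Type*} [Fintype m] [Fintype n]
    (T : Matrix m n ℤ) (u : m → ℤ) {X : ℤ} (hT : ∀ i j, |T i j| ≤ X) (hu : ∀ i, |u i| ≤ X)
    {ζ : n → ℝ} (h : T.map (fun z => (z : ℝ)) *ᵥ ζ = fun i => (u i : ℝ))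
    (hb : ∀ d : n → ℝ, (∀ k, ζ k = 0 → d k = 0) → T.map (fun z => (z : ℝ)) *ᵥ d = 0 → d = 0)
    (hY : 1 ≤ Fintype.card m * X ^ 2) (k : n) :
    |ζ k| ≤ ((Fintype.card n).factorial * (Fintype.card m * X ^ 2) ^ Fintype.card n : ℤ) := by
  classical
  have hcard : Fintype.card {k // ζ k ≠ 0} ≤ Fintype.card n := Fintype.card_subtype_le _
  by_cases hk : ζ k = 0
  · rw [hk, abs_zero]
    have : (0 : ℤ) ≤ (Fintype.card n).factorial * (Fintype.card m * X ^ 2) ^ Fintype.card n := by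
      positivity
    exact_mod_cast this
  -- The columns on the support are linearly independent by `hb`, but `B` need not be square. The
  -- normal equations with matrix `Bᵀ * B` are square and nonsingular, at the price of entries up to
  -- `card m * X ^ 2`.
  let B : Matrix m {k // ζ k ≠ 0} ℤ := T.submatrix id Subtype.val
  let Br : Matrix m {k // ζ k ≠ 0} ℝ := B.map (fun z => (z : ℝ))
  have hsum : ∀ w : n → ℝ, (∀ k, ζ k = 0 → w k = 0) →
      T.map (fun z => (z : ℝ)) *ᵥ w = Br *ᵥ fun k => w k := by
    intro w hw
    ext i
    simp only [Matrix.mulVec, dotProduct, Matrix.map_apply, Br, B, Matrix.submatrix_apply, id]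
    rw [← Finset.sum_subtype (Finset.univ.filter fun k => ζ k ≠ 0) (by simp)
      (fun k => (T i k : ℝ) * w k)]
    symm
    exact Finset.sum_filter_of_ne (p := fun k => ζ k ≠ 0) (f := fun k => (T i k : ℝ) * w k)
      fun k _ hk h0 => hk (by rw [hw k h0, mul_zero])
  have hmap : (Bᵀ * B).map (fun z => (z : ℝ)) = Brᵀ * Br := by
    ext i j; simp [Matrix.mul_apply, Br]
  have hdet : (Bᵀ * B).det ≠ 0 := by
    intro h0
    have h1 : (Brᵀ * Br).det = 0 := by
      rw [← hmap]
      exact (((Int.castRingHom ℝ).map_det (Bᵀ * B)).symm).trans (by simp [h0])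
    obtain ⟨w, hw0, hw⟩ := Matrix.exists_mulVec_eq_zero_iff.2 h1
    -- `‖B w‖² = wᵀ (Bᵀ B) w = 0`. Extended by zero, `w` becomes a kernel direction supported on the
    -- support of `ζ`.
    have h2 : Br *ᵥ w = 0 := by
      rw [← dotProduct_self_eq_zero, Matrix.dotProduct_mulVec, ← Matrix.mulVec_transpose,
        Matrix.mulVec_mulVec, hw, zero_dotProduct]
    let d : n → ℝ := fun k => if hk : ζ k ≠ 0 then w ⟨k, hk⟩ else 0
    have hd : ∀ k, ζ k = 0 → d k = 0 := fun k hk => by simp [d, hk]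
    have hdw : (fun k : {k // ζ k ≠ 0} => d k) = w := by
      ext k; simp [d, k.2]
    have h3 := hb d hd (by rw [hsum d hd, hdw, h2])
    exact hw0 (by rw [← hdw, h3]; rfl)
  have hentry : ∀ (a b : m → ℤ), (∀ i, |a i| ≤ X) → (∀ i, |b i| ≤ X) →
      |∑ i, a i * b i| ≤ Fintype.card m * X ^ 2 := by
    intro a b ha hb
    calc |∑ i, a i * b i| ≤ ∑ i, |a i * b i| := Finset.abs_sum_le_sum_abs _ _
      _ ≤ ∑ _i : m, X ^ 2 := Finset.sum_le_sum fun i _ => by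
          rw [abs_mul, sq]
          exact mul_le_mul (ha i) (hb i) (abs_nonneg _) ((abs_nonneg _).trans (ha i))
      _ = _ := by simp
  have h1 := Matrix.abs_le_of_mulVec_eq (Bᵀ * B) (Bᵀ *ᵥ u) (X := Fintype.card m * X ^ 2)
    (fun i j => hentry _ _ (fun r => hT r i) (fun r => hT r j))
    (fun i => hentry _ _ (fun r => hT r i) hu) hdet (ξ := fun k => ζ k) (by
      rw [hmap, ← Matrix.mulVec_mulVec, ← hsum ζ (fun _ h => h), h]
      ext i
      simp [Matrix.mulVec, dotProduct, Br]) ⟨k, hk⟩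
  refine h1.trans ?_
  have h2 : ((Fintype.card {k // ζ k ≠ 0}).factorial : ℤ) ≤ (Fintype.card n).factorial := by
    exact_mod_cast Nat.factorial_le hcard
  -- Raising the exponent from the support size to `card n` requires a base of at least `1`.
  have h3 := pow_le_pow_right₀ hY hcard
  exact_mod_cast mul_le_mul h2 h3 (by positivity) (by positivity)

/-! ### Bit lengths of rational data. -/

theorem natAbs_num_lt_two_pow_ratBits (r : ℚ) : r.num.natAbs < 2 ^ ratBits r :=
  (Nat.lt_size_self _).trans_le (Nat.pow_le_pow_right two_pos (by unfold ratBits; omega))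

theorem den_le_two_pow_ratBits (r : ℚ) : r.den ≤ 2 ^ ratBits r :=
  (Nat.lt_size_self _).le.trans (Nat.pow_le_pow_right two_pos (by unfold ratBits; omega))

theorem one_le_ratBits (r : ℚ) : 1 ≤ ratBits r := by unfold ratBits; omega

theorem ratBits_le_vecBits {n : Type} [Fintype n] (v : n → ℚ) (i : n) :
    ratBits (v i) ≤ vecBits v :=
  Finset.single_le_sum (f := fun i => ratBits (v i)) (fun _ _ => Nat.zero_le _) (Finset.mem_univ i)

theorem ratBits_le_matBits {m n : Type} [Fintype m] [Fintype n] (B : Matrix m n ℚ) (i : m)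
    (j : n) : ratBits (B i j) ≤ matBits B :=
  (ratBits_le_vecBits (B i) j).trans (Finset.single_le_sum (f := fun i => vecBits (B i))
    (fun _ _ => Nat.zero_le _) (Finset.mem_univ i))

theorem card_mul_card_le_matBits {m n : Type} [Fintype m] [Fintype n] (B : Matrix m n ℚ) :
    Fintype.card m * Fintype.card n ≤ matBits B := by
  calc Fintype.card m * Fintype.card n = ∑ _i : m, ∑ _j : n, 1 := by simp
    _ ≤ matBits B := Finset.sum_le_sum fun i _ => Finset.sum_le_sum fun j _ => one_le_ratBits _

/-- A rational linear system can be scaled to an integer one of comparable bit length. -/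
theorem exists_integer_scaling {m n : Type} [Fintype m] [Fintype n] (S : Matrix m n ℚ)
    (t : m → ℚ) :
    ∃ (a : ℕ) (T : Matrix m n ℤ) (u : m → ℤ), a ≠ 0 ∧ (∀ i j, (T i j : ℚ) = a * S i j) ∧
      (∀ i, (u i : ℚ) = a * t i) ∧ (∀ i j, |T i j| ≤ 2 ^ (2 * (matBits S + vecBits t))) ∧
      ∀ i, |u i| ≤ 2 ^ (2 * (matBits S + vecBits t)) := by
  -- The product of all denominators is at most `2` to the total bit length. An entry `r` becomes
  -- `(a / r.den) * r.num`, each factor obeying that bound, whence the factor `2` in the exponent.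
  let a : ℕ := (∏ i, ∏ j, (S i j).den) * ∏ i, (t i).den
  have ha0 : a ≠ 0 := by
    simp only [a, mul_ne_zero_iff, Finset.prod_ne_zero_iff]
    exact ⟨fun i _ j _ => (S i j).den_ne_zero, fun i _ => (t i).den_ne_zero⟩
  have ha : a ≤ 2 ^ (matBits S + vecBits t) := by
    rw [pow_add, matBits, vecBits, ← Finset.prod_pow_eq_pow_sum, ← Finset.prod_pow_eq_pow_sum]
    simp only [← Finset.prod_pow_eq_pow_sum]
    exact Nat.mul_le_mul (Finset.prod_le_prod' fun i _ => Finset.prod_le_prod' fun j _ =>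
      den_le_two_pow_ratBits _) (Finset.prod_le_prod' fun i _ => den_le_two_pow_ratBits _)
  have key : ∀ r : ℚ, r.den ∣ a → ratBits r ≤ matBits S + vecBits t →
      ∃ z : ℤ, (z : ℚ) = a * r ∧ |z| ≤ 2 ^ (2 * (matBits S + vecBits t)) := by
    rintro r ⟨c, hc⟩ hr
    refine ⟨c * r.num, ?_, ?_⟩
    · rw [hc]
      push_cast
      rw [mul_comm (r.den : ℚ), mul_assoc, mul_comm (r.den : ℚ), Rat.mul_den_eq_num]
    · have hca : c ≤ a := Nat.le_of_dvd (Nat.pos_of_ne_zero ha0) ⟨r.den, by rw [hc, mul_comm]⟩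
      have h1 : r.num.natAbs ≤ 2 ^ (matBits S + vecBits t) :=
        (natAbs_num_lt_two_pow_ratBits r).le.trans (Nat.pow_le_pow_right two_pos hr)
      have h2 : (c * r.num : ℤ).natAbs ≤ 2 ^ (2 * (matBits S + vecBits t)) := by
        rw [Int.natAbs_mul, Int.natAbs_natCast, two_mul, pow_add]
        exact Nat.mul_le_mul (hca.trans ha) h1
      rw [Int.abs_eq_natAbs]
      exact_mod_cast h2
  have hS : ∀ i j, ∃ z : ℤ, (z : ℚ) = a * S i j ∧ |z| ≤ 2 ^ (2 * (matBits S + vecBits t)) :=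
    fun i j => key _ (Dvd.dvd.mul_right ((Finset.dvd_prod_of_mem _ (Finset.mem_univ j)).trans
      (Finset.dvd_prod_of_mem (fun i => ∏ j, (S i j).den) (Finset.mem_univ i))) _)
      ((ratBits_le_matBits S i j).trans (Nat.le_add_right _ _))
  have ht : ∀ i, ∃ z : ℤ, (z : ℚ) = a * t i ∧ |z| ≤ 2 ^ (2 * (matBits S + vecBits t)) :=
    fun i => key _ (Dvd.dvd.mul_left (Finset.dvd_prod_of_mem (fun i => (t i).den)
      (Finset.mem_univ i)) _) ((ratBits_le_vecBits t i).trans (Nat.le_add_left _ _))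
  choose T hT using hS
  choose u hu using ht
  exact ⟨a, T, u, ha0, fun i j => (hT i j).1, fun i => (hu i).1, fun i j => (hT i j).2,
    fun i => (hu i).2⟩

theorem ratBits_zero : ratBits 0 = 2 := by simp [ratBits]

theorem ratBits_one : ratBits 1 = 3 := by simp [ratBits]

theorem ratBits_neg_two_pow (q : ℕ) : ratBits (-2 ^ q) = q + 3 := by
  have : (-2 ^ q : ℚ) = ((-2 ^ q : ℤ) : ℚ) := by push_cast; rfl
  rw [ratBits, this, Rat.num_intCast, Rat.den_intCast, Int.natAbs_neg, Int.natAbs_pow]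
  have : Nat.size ((2 : ℤ).natAbs ^ q) = q + 1 := Nat.size_pow
  rw [this]
  simp
  ring

theorem matBits_le {m n : Type} [Fintype m] [Fintype n] (B : Matrix m n ℚ) {c : ℕ}
    (h : ∀ i j, ratBits (B i j) ≤ c) : matBits B ≤ Fintype.card m * Fintype.card n * c := by
  calc matBits B ≤ ∑ _i : m, ∑ _j : n, c :=
        Finset.sum_le_sum fun i _ => Finset.sum_le_sum fun j _ => h i j
    _ = _ := by simp [mul_assoc]

theorem matBits_fromCols {m n₁ n₂ : Type} [Fintype m] [Fintype n₁] [Fintype n₂]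
    (A : Matrix m n₁ ℚ) (B : Matrix m n₂ ℚ) :
    matBits (Matrix.fromCols A B) = matBits A + matBits B := by
  simp [matBits, Finset.sum_add_distrib]

theorem matBits_fromRows {m₁ m₂ n : Type} [Fintype m₁] [Fintype m₂] [Fintype n]
    (A : Matrix m₁ n ℚ) (B : Matrix m₂ n ℚ) :
    matBits (Matrix.fromRows A B) = matBits A + matBits B := by
  simp [matBits]

theorem matBits_zero {m n : Type} [Fintype m] [Fintype n] :
    matBits (0 : Matrix m n ℚ) = Fintype.card m * Fintype.card n * 2 := by
  simp [matBits, ratBits_zero, mul_assoc]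

theorem matBits_padMatrix {M K : ℕ} (L Q : ℕ) (B : Matrix (Fin M) (Fin K) ℚ) :
    matBits (padMatrix L Q B) = 4 * (M * (L * Q)) + matBits B := by
  rw [padMatrix, matBits_fromCols, matBits_fromCols, matBits_zero]
  simp
  ring

theorem vecBits_padVector {K : ℕ} (L Q : ℕ) (v : Fin K → ℚ) :
    vecBits (padVector L Q v) = 4 * (L * Q) + vecBits v := by
  simp [vecBits, padVector, ratBits_zero]
  ring

/-! ### Size of the copositive program. -/

namespace RobustQP

variable {D M K J L N : ℕ}

theorem matBits_expS_le (P : RobustQP ℚ D M K J L N) (Q : ℕ) :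
    matBits (P.expS Q) ≤ 4 * (J * (L * Q)) + matBits P.S
      + (L * (L * Q) * (Q + 3) + L * (L * Q) * 2 + L * K * 3)
      + (6 * (L * Q * (L * Q)) + 2 * (L * Q * K)) := by
  have h1 : matBits (-binaryWeights ℚ L Q) ≤ L * (L * Q) * (Q + 3) := by
    refine (matBits_le _ (c := Q + 3) fun l p => ?_).trans (by simp)
    simp only [Matrix.neg_apply, binaryWeights, Matrix.of_apply]
    split_ifs
    · rw [ratBits_neg_two_pow]; have := p.2.2; omega
    · rw [neg_zero, ratBits_zero]; omega
  have h2 : matBits (firstCoords ℚ P.hL) ≤ L * K * 3 := by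
    refine (matBits_le _ (c := 3) fun l k => ?_).trans (by simp)
    simp only [firstCoords, Matrix.of_apply]
    split_ifs
    · rw [ratBits_one]
    · rw [ratBits_zero]; omega
  have h3 : matBits (1 : Matrix (Fin L × Fin Q) (Fin L × Fin Q) ℚ) ≤ L * Q * (L * Q) * 3 := by
    refine (matBits_le _ (c := 3) fun l k => ?_).trans (by simp)
    rw [Matrix.one_apply]
    split_ifs
    · rw [ratBits_one]
    · rw [ratBits_zero]; omega
  rw [expS]
  simp only [matBits_fromRows, matBits_fromCols, matBits_zero, Fintype.card_fin, Fintype.card_prod]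
  linarith

theorem vecBits_expT (P : RobustQP ℚ D M K J L N) (Q : ℕ) :
    vecBits (P.expT Q) = vecBits P.t + (2 * L + 3 * (L * Q)) := by
  simp [vecBits, expT, ratBits_zero, ratBits_one]
  ring

/-- Every dimension, `L * Q` and `Q + 1` are at most `W = (n + 1) * (R + 1)`, and every term of the
size has degree at most three in these quantities; the cubic ones come from the padded `A₁` and the
binary weights. The constant `100` leaves room for all coefficients. -/
theorem copSize_le (P : RobustQP ℚ D M K J L N) {n Q R : ℕ} (hn : P.inputSize = n) (hQ : Q ≤ R) :
    P.copSize Q ≤ 100 * ((n + 1) * (R + 1)) ^ 3 := by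
  have hS := P.matBits_expS_le Q
  have hT := P.vecBits_expT Q
  simp only [inputSize, setBits] at hn
  simp only [copSize, copNumVars, copConstraintSize, copDataBits, matBits_padMatrix,
    vecBits_padVector, Finset.sum_add_distrib, Finset.sum_const, Finset.card_univ,
    Fintype.card_sum, Fintype.card_prod, Fintype.card_fin, Fintype.card_unit, smul_eq_mul]
  set W := (n + 1) * (R + 1) with hW
  have hnW : n + 1 ≤ W := Nat.le_mul_of_pos_right _ (Nat.succ_pos R)
  have hRW : R + 1 ≤ W := Nat.le_mul_of_pos_left _ (Nat.succ_pos n)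
  have hp : L * Q ≤ W := Nat.mul_le_mul (by omega) (by omega)
  generalize L * Q = p at *
  have hDW : D ≤ W := by omega
  have hMW : M ≤ W := by omega
  have hKW : K ≤ W := by omega
  have hJW : J ≤ W := by omega
  have hLW : L ≤ W := by omega
  have hV : (p + (p + K)) ^ 2 ≤ 9 * W ^ 2 :=
    (Nat.pow_le_pow_left (by omega : p + (p + K) ≤ 3 * W) 2).trans (by rw [mul_pow]; norm_num)
  have hMp : M * p ≤ W ^ 2 := (Nat.mul_le_mul hMW hp).trans_eq (sq W).symm
  have hDp : D * (4 * p) ≤ 4 * W ^ 2 := by nlinarith [Nat.mul_le_mul hDW hp]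
  have hDMp : D * (4 * (M * p)) ≤ 4 * W ^ 3 := by nlinarith [Nat.mul_le_mul hDW hMp]
  have hJp : J * p ≤ W ^ 2 := (Nat.mul_le_mul hJW hp).trans_eq (sq W).symm
  have hLp : L * p ≤ W ^ 2 := (Nat.mul_le_mul hLW hp).trans_eq (sq W).symm
  have hLpQ : L * p * (Q + 3) ≤ 3 * W ^ 3 :=
    (Nat.mul_le_mul hLp (by omega : Q + 3 ≤ 3 * W)).trans_eq (by ring)
  have hLK : L * K ≤ W ^ 2 := (Nat.mul_le_mul hLW hKW).trans_eq (sq W).symm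
  have hpp : p * p ≤ W ^ 2 := (Nat.mul_le_mul hp hp).trans_eq (sq W).symm
  have hpK : p * K ≤ W ^ 2 := (Nat.mul_le_mul hp hKW).trans_eq (sq W).symm
  have hW0 : 1 ≤ W := by omega
  have hW1 : W ≤ W ^ 3 := Nat.le_self_pow (by norm_num) W
  have hW2 : W ^ 2 ≤ W ^ 3 := Nat.pow_le_pow_right hW0 (by norm_num)
  omega

/-! ### A polynomial number of bits suffices. -/

theorem toReal_S_mulVec_ratCast (P : RobustQP ℚ D M K J L N) (a : Fin K → ℚ) :
    P.toReal.S *ᵥ (fun k => (a k : ℝ)) = fun j => (((P.S *ᵥ a) j : ℚ) : ℝ) := by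
  ext j
  simp [toReal, Matrix.mulVec, dotProduct]

/-- The continuous relaxation of a nonempty bounded rational mixed-integer set has no nonzero
recession direction. -/
theorem toReal_recession_eq_zero (P : RobustQP ℚ D M K J L N)
    (hne : P.toReal.uncertaintySet.Nonempty)
    (hbd : Bornology.IsBounded P.toReal.uncertaintySet) (d : Fin K → ℝ) (hd : 0 ≤ d)
    (hS : P.toReal.S *ᵥ d = 0) : d = 0 := by
  by_contra hd0
  obtain ⟨a, ha, ha0, hSa⟩ := P.S.exists_rat_mulVec_eq_zero hd hd0 hS
  -- Multiplying by all denominators makes every coordinate an integer, so the rational direction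
  -- contradicts boundedness of the mixed-integer set.
  let c : ℕ := ∏ k, (a k).den
  have hc : c ≠ 0 := Finset.prod_ne_zero_iff.2 fun k _ => (a k).den_ne_zero
  have hint : ∀ k, ∃ z : ℤ, (c : ℚ) * a k = z := fun k => by
    obtain ⟨e, he⟩ : (a k).den ∣ c := Finset.dvd_prod_of_mem (fun k => (a k).den) (Finset.mem_univ k)
    refine ⟨e * (a k).num, ?_⟩
    rw [he]
    push_cast
    rw [mul_comm ((a k).den : ℚ), mul_assoc, mul_comm ((a k).den : ℚ), Rat.mul_den_eq_num]
  have h := P.toReal.recession_eq_zero hne hbd (fun k => ((c * a k : ℚ) : ℝ))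
    (fun k => by
      have := ha k
      simp only [Pi.zero_apply] at this ⊢
      positivity)
    (by
      rw [toReal_S_mulVec_ratCast, show (fun k => (c : ℚ) * a k) = (c : ℚ) • a from rfl,
        Matrix.mulVec_smul, hSa]
      ext; simp)
    (fun l => by
      obtain ⟨z, hz⟩ := hint (Fin.castLE P.toReal.hL l)
      exact ⟨z, by rw [hz]; simp⟩)
  refine ha0 (funext fun k => ?_)
  have hk : ((c * a k : ℚ) : ℝ) = 0 := congrFun h k
  have hk' : (c : ℚ) * a k = 0 := by exact_mod_cast hk
  exact (mul_eq_zero.1 hk').resolve_left (by exact_mod_cast hc)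

/-- The coordinates of the points of a nonempty bounded rational mixed-integer set have
polynomially many bits. -/
theorem apply_le_of_mem_uncertaintySet (P : RobustQP ℚ D M K J L N)
    (hne : P.toReal.uncertaintySet.Nonempty)
    (hbd : Bornology.IsBounded P.toReal.uncertaintySet) {ξ : Fin K → ℝ}
    (hξ : ξ ∈ P.toReal.uncertaintySet) (k : Fin K) : ξ k ≤ 2 ^ (6 * P.setBits ^ 2) := by
  have htriv := P.toReal_recession_eq_zero hne hbd
  have hK : 0 < K := k.pos
  -- Without equations the all-ones vector would be a recession direction.
  have hJ : 0 < J := by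
    rcases Nat.eq_zero_or_pos J with rfl | h
    · have := htriv (fun _ => 1) (fun _ => zero_le_one) (Subsingleton.elim _ _)
      exact absurd (congrFun this k) one_ne_zero
    · exact h
  obtain ⟨ζ, hζ0, hζ, hle, hb⟩ := P.toReal.S.exists_basic_solution_ge htriv k ξ hξ.1
  obtain ⟨a, T, u, ha, hT, hu, hTX, huX⟩ := exists_integer_scaling P.S P.t
  have ha' : (a : ℝ) ≠ 0 := by exact_mod_cast ha
  have hTr : T.map (fun z => (z : ℝ)) = (a : ℝ) • P.toReal.S := by
    ext i j
    have := hT i j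
    simp only [Matrix.map_apply, Matrix.smul_apply, toReal, smul_eq_mul]
    exact_mod_cast congrArg (Rat.cast : ℚ → ℝ) this
  have hur : (fun i => (u i : ℝ)) = (a : ℝ) • P.toReal.t := by
    ext i
    have := hu i
    simp only [Pi.smul_apply, toReal, smul_eq_mul]
    exact_mod_cast congrArg (Rat.cast : ℚ → ℝ) this
  change ∀ i j, |T i j| ≤ 2 ^ (2 * P.setBits) at hTX
  change ∀ i, |u i| ≤ 2 ^ (2 * P.setBits) at huX
  have hJK : J * K ≤ P.setBits := by
    have := card_mul_card_le_matBits P.S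
    simp only [Fintype.card_fin] at this
    exact this.trans (Nat.le_add_right _ _)
  have hJs : J ≤ P.setBits := (Nat.le_mul_of_pos_right J hK).trans hJK
  have hKs : K ≤ P.setBits := (Nat.le_mul_of_pos_left K hJ).trans hJK
  have hmain := Matrix.abs_le_of_basic_solution T u hTX huX (ζ := ζ)
    (by rw [hTr, hur, Matrix.smul_mulVec, hζ, hξ.2.1])
    (fun d hd h => hb d hd (by
      rw [hTr, Matrix.smul_mulVec] at h
      exact (smul_eq_zero.1 h).resolve_left ha'))
    (by
      rw [Fintype.card_fin]
      have : (1 : ℤ) ≤ J := by exact_mod_cast hJ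
      have h2 : (1 : ℤ) ≤ (2 ^ (2 * P.setBits)) ^ 2 := one_le_pow₀ (one_le_pow₀ (by norm_num))
      nlinarith) k
  simp only [Fintype.card_fin] at hmain
  -- With `s = setBits`: `K! ≤ 2 ^ (s K)`, and the base is at most `2 ^ s * 2 ^ (4 s)`, giving `2 ^
  -- (6 s K)`; finally `K ≤ s`.
  have hfin : K.factorial * (J * (2 ^ (2 * P.setBits)) ^ 2) ^ K ≤ 2 ^ (6 * P.setBits ^ 2) := by
    generalize P.setBits = s at *
    have hs : s ≤ 2 ^ s := Nat.lt_two_pow_self.le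
    calc K.factorial * (J * (2 ^ (2 * s)) ^ 2) ^ K
        ≤ (2 ^ s) ^ K * (2 ^ s * (2 ^ (2 * s)) ^ 2) ^ K := by
          refine Nat.mul_le_mul ((Nat.factorial_le_pow K).trans ?_) ?_
          · exact Nat.pow_le_pow_left (hKs.trans hs) K
          · exact Nat.pow_le_pow_left (Nat.mul_le_mul_right _ (hJs.trans hs)) K
      _ = 2 ^ (6 * s * K) := by rw [← mul_pow, ← pow_mul, ← pow_add, ← pow_add, ← pow_mul]; ring_nf
      _ ≤ 2 ^ (6 * s ^ 2) := Nat.pow_le_pow_right two_pos (by nlinarith)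
  calc ξ k ≤ |ζ k| := hle.trans (le_abs_self _)
    _ ≤ _ := hmain
    _ ≤ _ := by exact_mod_cast hfin

/-- One bit beyond the exponent `6 s²` absorbs the `-1` in `2 ^ Q - 1`. -/
theorem toReal_isBitBound (P : RobustQP ℚ D M K J L N)
    (hne : P.toReal.uncertaintySet.Nonempty)
    (hbd : Bornology.IsBounded P.toReal.uncertaintySet) :
    P.toReal.IsBitBound (6 * P.setBits ^ 2 + 1) := by
  intro ξ hξ l
  have h1 := P.apply_le_of_mem_uncertaintySet hne hbd hξ (Fin.castLE P.toReal.hL l)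
  have h2 : (1 : ℝ) ≤ 2 ^ (6 * P.setBits ^ 2) := one_le_pow₀ (by norm_num)
  rw [pow_succ]
  linarith

end RobustQP

theorem mainTheorem2 :
    (∀ (D M K J L N : ℕ) (P : RobustQP ℝ D M K J L N),
      ConvexOn ℝ P.X P.c →
      P.uncertaintySet.Nonempty →
      Bornology.IsBounded P.uncertaintySet →
      (∃ Q : ℕ, P.IsBitBound Q) ∧
      ∀ Q : ℕ, P.IsBitBound Q →
        (∀ x ∈ P.X, P.worstCase x = P.copSectionValue Q x) ∧
        P.robustValue = P.copValue Q ∧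
        (∀ x ∈ P.X, P.IsRobustOptimal x ↔ P.copSectionValue Q x = P.copValue Q) ∧
        (∀ (x : Fin D → ℝ) (y : CopVars K J L Q), P.IsCopOptimal Q x y →
          P.IsRobustOptimal x ∧ P.worstCase x = (P.copObjective Q x y : EReal))) ∧
    (∃ p q : Polynomial ℕ, ∀ (D M K J L N : ℕ) (P : RobustQP ℚ D M K J L N),
      P.toReal.uncertaintySet.Nonempty →
      Bornology.IsBounded P.toReal.uncertaintySet →
      ∃ Q : ℕ, P.toReal.IsBitBound Q ∧
        Q ≤ p.eval P.setBits ∧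
        P.copSize Q ≤ q.eval P.inputSize) := by
  refine ⟨fun D M K J L N P _ hne hbd => ⟨P.exists_isBitBound hbd, fun Q hQ =>
    ⟨fun x hx => P.worstCase_eq_copSectionValue hne hbd hQ hx,
      P.robustValue_eq_copValue hne hbd hQ,
      fun x hx => P.isRobustOptimal_iff hne hbd hQ hx,
      fun x y h => h.isRobustOptimal hne hbd hQ⟩⟩,
    -- The second polynomial is the bound of `copSize_le` with `R = 6 n² + 1`, using that `setBits`
    -- is at most the input size `n`.
    6 * Polynomial.X ^ 2 + 1, 100 * ((Polynomial.X + 1) * (6 * Polynomial.X ^ 2 + 1 + 1)) ^ 3,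
    fun D M K J L N P hne hbd =>
      ⟨6 * P.setBits ^ 2 + 1, P.toReal_isBitBound hne hbd, by simp, ?_⟩⟩
  have hle : P.setBits ≤ P.inputSize := Nat.le_add_left _ _
  have hR : 6 * P.setBits ^ 2 + 1 ≤ 6 * P.inputSize ^ 2 + 1 := by gcongr
  simpa using P.copSize_le rfl hR
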